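/- Let $\mathcal H$ be a complex separable Hilbert space and let $B(\mathcal H)$ be the algebra of bounded linear operators on $\mathcal H$. Order the self-adjoint projections on $\mathcal H$ by $P\le Q$ if $PQ=P$; suprema and infima of projections are the projections onto the closed linear span and onto the intersection of the ranges, respectively. A *nest* is a totally ordered lattice $\mathcal L$ of self-adjoint projections on $\mathcal H$ that contains $0$ and $I$ and is closed in the strong operator topology. It is *continuous* if $P=P_-$ for every $P\in\mathcal L$, where $P_-=\bigvee\{Q\in\mathcal L : Q<P\}$ (so $0_-=0$). Its *nest algebra* is $$\mathcal T(\mathcal L)=\{T\in B(\mathcal H) : T(P\mathcal H)\subseteq P\mathcal H \text{ for all } P\in\mathcal L\}.$$ A *Lie $\mathcal T(\mathcal L)$-module* is a linear subspace $\mathcal M$ of $B(\mathcal H)$ such that $[A,B]=AB-BA\in\mathcal M$ for all $A\in\mathcal M$ and $B\in\mathcal T(\mathcal L)$. **Theorem.** Let $\mathcal L$ be a continuous nest on $\mathcal H$. Then every norm closed Lie $\mathcal T(\mathcal L)$-module $\mathcal M$ is decomposable, that is, every finite rank operator in $\mathcal M$ is a sum of finitely many rank-1 operators lying in $\mathcal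 M$ (the zero operator being the empty sum). -/

import Mathlib

namespace ContinuousNest

noncomputable section

variable {H : Type*} [NormedAddCommGroup H] [InnerProductSpace ℂ H] [CompleteSpace H]

/-- The supremum of a family of self-adjoint projections: the projection onto the closure of the
linear span of their ranges. (It is `0` for the empty family.) -/
def projSup (S : Set (H →L[ℂ] H)) : H →L[ℂ] H :=
  (⨆ P ∈ S, P.range).topologicalClosure.starProjection

/-- The infimum of a family of self-adjoint projections: the projection onto the intersection of
their ranges. (That intersection is already closed; taking the closure only serves to form the
projection.) -/
def projInf (S : Set (H →L[ℂ] H)) : H →L[ℂ] H :=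
  (⨅ P ∈ S, P.range).topologicalClosure.starProjection

/-- The order on self-adjoint projections: `P ≤ Q` when `P Q = P`. -/
def ProjLE (P Q : H →L[ℂ] H) : Prop := P * Q = P

/-- The strict order on self-adjoint projections. -/
def ProjLT (P Q : H →L[ℂ] H) : Prop := ProjLE P Q ∧ P ≠ Q

/-- A subspace lattice: a lattice of self-adjoint projections containing `0` and the identity and
closed in the strong operator topology (the topology of pointwise convergence). -/
structure IsSubspaceLattice (L : Set (H →L[ℂ] H)) : Prop where
  isStarProjection : ∀ P ∈ L, IsStarProjection P
  zero_mem : 0 ∈ L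
  one_mem : 1 ∈ L
  sup_mem : ∀ P ∈ L, ∀ Q ∈ L, projSup {P, Q} ∈ L
  inf_mem : ∀ P ∈ L, ∀ Q ∈ L, projInf {P, Q} ∈ L
  strongly_closed :
    IsClosed (ContinuousLinearMap.toPointwiseConvergenceCLM ℂ (RingHom.id ℂ) H H '' L)

/-- A nest: a totally ordered subspace lattice. -/
structure IsNest (L : Set (H →L[ℂ] H)) : Prop extends IsSubspaceLattice L where
  total : ∀ P ∈ L, ∀ Q ∈ L, ProjLE P Q ∨ ProjLE Q P

/-- The projection `P₋`, the supremum of all `Q` in `L` with `Q < P`. -/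
def predProj (L : Set (H →L[ℂ] H)) (P : H →L[ℂ] H) : H →L[ℂ] H :=
  projSup {Q | Q ∈ L ∧ ProjLT Q P}

/-- A continuous nest: a nest with `P₋ = P` for all of its elements `P`. -/
structure IsContinuousNest (L : Set (H →L[ℂ] H)) : Prop extends IsNest L where
  pred_eq : ∀ P ∈ L, predProj L P = P

/-- The algebra of all bounded operators leaving invariant the range of every `P` in `L`. -/
def nestAlgebra (L : Set (H →L[ℂ] H)) : Subalgebra ℂ (H →L[ℂ] H) where
  carrier := {T | ∀ P ∈ L, ∀ x ∈ P.range, T x ∈ P.range}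
  mul_mem' := fun hS hT P hP x hx => hS P hP _ (hT P hP x hx)
  add_mem' := fun hS hT P hP x hx => add_mem (hS P hP x hx) (hT P hP x hx)
  algebraMap_mem' := fun c P _ x hx => by
    simpa [Algebra.algebraMap_eq_smul_one] using P.range.smul_mem c hx

/-- A Lie module over the nest algebra of `L`: a subspace `M` of `B(H)` such that
`[A, B] = A B - B A` is in `M` for all `A` in `M` and all `B` in the nest algebra. -/
def IsLieModule (L : Set (H →L[ℂ] H)) (M : Submodule ℂ (H →L[ℂ] H)) : Prop :=
  ∀ A ∈ M, ∀ B ∈ nestAlgebra L, A * B - B * A ∈ M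

/-- A finite rank operator. -/
def IsFiniteRank (T : H →L[ℂ] H) : Prop := FiniteDimensional ℂ T.range

/-- A rank-1 operator. -/
def IsRankOne (T : H →L[ℂ] H) : Prop := Module.finrank ℂ T.range = 1

/-- A set `X` of bounded operators is decomposable if every finite rank operator in `X` is a sum of
finitely many rank-1 operators in `X` (the zero operator being the empty sum). -/
def IsDecomposable (X : Set (H →L[ℂ] H)) : Prop :=
  ∀ T ∈ X, IsFiniteRank T →
    ∃ (n : ℕ) (R : Fin n → (H →L[ℂ] H)), (∀ i, R i ∈ X ∧ IsRankOne (R i)) ∧ T = ∑ i, R i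

end

end ContinuousNest

/-!
Write `u ⊗ v` for the rank-one operator `z ↦ ⟪v, z⟫ u`, that is `InnerProductSpace.rankOne ℂ u v`.
It belongs to the nest algebra as soon as some `P` in the nest satisfies `P u = u` and `P v = 0`.

The proof compares a finite rank operator `T` in `M` with the operators that are *subordinate* to
it, those that map the range of `P` into that of `Q` whenever `T` does (`P`, `Q` in the nest).

* `T` is a finite sum of subordinate rank-one operators (`exists_sum_rankOne_subordinate`). For
  this, choose `P₀` in the nest with `T P₀` nonzero and of the smallest dimension, and a unit
  vector `x` in the range of `T P₀`. Then `(x ⊗ x) T` is subordinate to `T`, and subtracting it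
  lowers the rank.
* Each subordinate `u ⊗ v` lies in `M` (`IsLieModule.rankOne_mem_of_subordinate`). By continuity of
  the nest there are `P`, `Q` in it with `P v ≠ 0` and `Q u ≠ u`, both `P v` and `u - Q u` being
  arbitrarily small. Then `T` cannot map the range of `P` into that of `Q`, and it is enough that
  `M` contains `Q u ⊗ (1 - P) v`.

The heart is therefore `IsLieModule.rankOne_mem`: if `T` does not map the range of `P` into that of
`Q`, then `M` contains every `u ⊗ v` with `Q u = u` and `P v = 0`. Brackets with projections of the
nest put the corners `P T (1 - P)` and `(1 - P) T P` into `M`, and brackets with rank-one operators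
of the nest algebra then move a nonzero corner to the desired position. When the corner is below
the diagonal (`P ≤ Q`), double brackets give this for `u ⟂ v` only. The restriction is removed by
cutting the nest into intervals `E` on which `v` is small: the off-diagonal parts `E u ⊗ (1 - E) v`
are in `M`, and the block-diagonal part `∑ E u ⊗ E v` is small in norm
(`IsContinuousNest.rankOne_mem_of_off_diagonal`). When `Q ≤ P` and no corner below the diagonal is
available, `T` leaves all `R` between `Q` and `P` invariant. A nonzero finite rank operator cannot
be concentrated on the diagonal of a continuous nest, so some `(R - Q) T (P - R)` is nonzero.
-/

open InnerProductSpace Filter Topology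

namespace ContinuousNest

variable {H : Type*} [NormedAddCommGroup H] [InnerProductSpace ℂ H]

/-! ### Totally ordered families of projections -/

section Projections

variable {P Q : H →L[ℂ] H}

theorem ProjLE.apply (h : ProjLE P Q) (x : H) : P (Q x) = P x :=
  congrArg (fun A : H →L[ℂ] H => A x) h

variable [CompleteSpace H]

theorem idem_apply (hP : IsStarProjection P) (x : H) : P (P x) = P x :=
  congrArg (fun A : H →L[ℂ] H => A x) hP.isIdempotentElem.eq

theorem inner_apply_left (hP : IsStarProjection P) (x y : H) :
    inner ℂ (P x) y = inner ℂ x (P y) := by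
  rw [← ContinuousLinearMap.adjoint_inner_left, ← ContinuousLinearMap.star_eq_adjoint,
    hP.isSelfAdjoint.star_eq]

theorem mem_range_iff (hP : IsStarProjection P) {x : H} : x ∈ P.range ↔ P x = x :=
  ⟨by rintro ⟨y, rfl⟩; exact idem_apply hP y, fun h => ⟨x, h⟩⟩

theorem inner_self_apply (hP : IsStarProjection P) (x : H) :
    inner ℂ x (P x) = (‖P x‖ : ℂ) ^ 2 := by
  have h := inner_self_eq_norm_sq_to_K (𝕜 := ℂ) (P x)
  rwa [inner_apply_left hP, idem_apply hP] at h

theorem ProjLE.apply' (hP : IsStarProjection P) (hQ : IsStarProjection Q) (h : ProjLE P Q)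
    (x : H) : Q (P x) = P x := by
  have h' := congrArg star (show P * Q = P from h)
  rw [star_mul, hP.isSelfAdjoint.star_eq, hQ.isSelfAdjoint.star_eq] at h'
  exact congrArg (fun A : H →L[ℂ] H => A x) h'

theorem projLE_iff_range_le (hP : IsStarProjection P) (hQ : IsStarProjection Q) :
    ProjLE P Q ↔ P.range ≤ Q.range := by
  constructor
  · rintro h _ ⟨x, rfl⟩
    exact ⟨P x, h.apply' hP hQ x⟩
  · intro h
    ext x
    refine ext_inner_right ℂ fun y => ?_
    have : Q (P y) = P y := (mem_range_iff hQ).1 (h ⟨y, rfl⟩)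
    rw [mul_apply_eq_comp, inner_apply_left hP, inner_apply_left hQ, this,
      inner_apply_left hP]

theorem norm_apply_le (hP : IsStarProjection P) (x : H) : ‖P x‖ ≤ ‖x‖ := by
  have h := norm_inner_le_norm (𝕜 := ℂ) x (P x)
  rw [inner_self_apply hP] at h
  simp only [norm_pow, Complex.norm_real, norm_norm] at h
  nlinarith [norm_nonneg (P x), norm_nonneg x]

/-- Pythagoras for the interval `Q - P` of two comparable projections. -/
theorem ProjLE.norm_sub_apply_sq (hP : IsStarProjection P)
    (h : ProjLE P Q) (x : H) : ‖Q x - P x‖ ^ 2 = ‖Q x‖ ^ 2 - ‖P x‖ ^ 2 := by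
  have h0 : inner ℂ (P x) (Q x - P x) = 0 := by
    rw [inner_apply_left hP, map_sub, h.apply, idem_apply hP, sub_self, inner_zero_right]
  have := norm_add_sq_eq_norm_sq_add_norm_sq_of_inner_eq_zero _ _ h0
  rw [add_sub_cancel] at this
  nlinarith

/-- The supremum of a totally ordered family of projections is a strong limit of its members. -/
theorem exists_filter_tendsto_projSup {S : Set (H →L[ℂ] H)}
    (hS : ∀ P ∈ S, IsStarProjection P) (hne : S.Nonempty)
    (htot : ∀ P ∈ S, ∀ Q ∈ S, ProjLE P Q ∨ ProjLE Q P) :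
    ∃ l : Filter (H →L[ℂ] H), l.NeBot ∧ (∀ᶠ P in l, P ∈ S) ∧
      ∀ x, Tendsto (fun P : H →L[ℂ] H => P x) l (𝓝 (projSup S x)) := by
  let R : Set (Submodule ℂ H) := (fun P : H →L[ℂ] H => P.range) '' S
  have hproj : ∀ U : R, ∃ _ : U.1.HasOrthogonalProjection, U.1.starProjection ∈ S := by
    rintro ⟨_, P, hP, rfl⟩
    obtain ⟨h, e⟩ := isStarProjection_iff_eq_starProjection_range.1 (hS P hP)
    exact ⟨h, e ▸ hP⟩
  have : ∀ U : R, U.1.HasOrthogonalProjection := fun U => (hproj U).1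
  have : Nonempty R := (hne.image _).to_subtype
  have : IsDirectedOrder R := ⟨by
    rintro ⟨_, P, hP, rfl⟩ ⟨_, Q, hQ, rfl⟩
    rcases htot P hP Q hQ with h | h
    · exact ⟨⟨_, Q, hQ, rfl⟩, (projLE_iff_range_le (hS _ hP) (hS _ hQ)).1 h, le_rfl⟩
    · exact ⟨⟨_, P, hP, rfl⟩, le_rfl, (projLE_iff_range_le (hS _ hQ) (hS _ hP)).1 h⟩⟩
  refine ⟨map (fun U : R => U.1.starProjection) atTop, inferInstance, ?_, fun x => ?_⟩
  · exact eventually_map.2 (Eventually.of_forall fun U : R => (hproj U).2)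
  · rw [tendsto_map'_iff]
    have e : (⨆ U : R, U.1) = ⨆ P ∈ S, P.range := by rw [← sSup_eq_iSup', sSup_image]
    have e' : (⨆ U : R, U.1).topologicalClosure.starProjection = projSup S := by
      unfold projSup
      congr 1
      rw [e]
    rw [← e']
    exact Submodule.starProjection_tendsto_closure_iSup (fun U : R => U.1) (fun U V h => h) x

end Projections

/-! ### Continuity of a continuous nest -/

section Nest

variable [CompleteSpace H] {L : Set (H →L[ℂ] H)}

theorem IsNest.mem_of_tendsto (hL : IsNest L) {l : Filter (H →L[ℂ] H)} [l.NeBot]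
    {f : (H →L[ℂ] H) → (H →L[ℂ] H)} (hf : ∀ᶠ P in l, f P ∈ L) {Q : H →L[ℂ] H}
    (h : ∀ x, Tendsto (fun P => f P x) l (𝓝 (Q x))) : Q ∈ L := by
  let ι := ContinuousLinearMap.toPointwiseConvergenceCLM ℂ (RingHom.id ℂ) H H
  have ht : Tendsto (fun P => ι (f P)) l (𝓝 (ι Q)) :=
    PointwiseConvergenceCLM.tendsto_iff_forall_tendsto.2 h
  obtain ⟨Q', hQ', e⟩ := hL.strongly_closed.mem_of_tendsto ht
    (hf.mono fun P hP => Set.mem_image_of_mem _ hP)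
  have : Q' = Q := by
    ext x
    exact congrArg (fun A => A x) e
  exact this ▸ hQ'

/-- A nonempty subset of a nest has a lower bound in the nest that is a strong limit of its
members. -/
theorem IsNest.exists_inf (hL : IsNest L) {S : Set (H →L[ℂ] H)} (hSL : S ⊆ L)
    (hne : S.Nonempty) :
    ∃ Q ∈ L, (∀ P ∈ S, ProjLE Q P) ∧ ∀ x, ∀ ε > 0, ∃ P ∈ S, ‖P x - Q x‖ < ε := by
  have hp : ∀ P ∈ S, IsStarProjection P := fun P h => hL.isStarProjection P (hSL h)
  obtain ⟨l, hl, hlS, hlim⟩ := exists_filter_tendsto_projSup (S := (fun P => 1 - P) '' S)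
    (by rintro _ ⟨P, h, rfl⟩; exact (hp P h).one_sub) (hne.image _) (by
      rintro _ ⟨P, h, rfl⟩ _ ⟨Q, h', rfl⟩
      have e : ∀ {P Q : H →L[ℂ] H}, P ∈ S → Q ∈ S → ProjLE P Q → ProjLE (1 - Q) (1 - P) := by
        intro P Q hP hQ h
        ext x
        have := h.apply' (hp P hP) (hp Q hQ) x
        simp [this]
      exact (hL.total P (hSL h) Q (hSL h')).symm.imp (e h' h) (e h h'))
  set K := projSup ((fun P => 1 - P) '' S)
  have hK : IsStarProjection K := isStarProjection_starProjection
  have hlS' : ∀ᶠ A in l, 1 - A ∈ S := hlS.mono (by rintro _ ⟨P, h, rfl⟩; simpa using h)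
  have hlim' : ∀ x, Tendsto (fun A : H →L[ℂ] H => (1 - A) x) l (𝓝 ((1 - K) x)) := fun x => by
    simpa using tendsto_const_nhds.sub (hlim x)
  refine ⟨1 - K, hL.mem_of_tendsto (hlS'.mono fun A h => hSL h) hlim', fun P hP => ?_, ?_⟩
  · have hKP : ProjLE (1 - P) K := by
      have hr : (1 - P).range ≤ K.range := by
        have : K.range = (⨆ A ∈ (fun P => 1 - P) '' S, A.range).topologicalClosure :=
          Submodule.range_starProjection _
        rw [this]
        exact (le_biSup (fun A : H →L[ℂ] H => A.range)
          (Set.mem_image_of_mem (fun P => 1 - P) hP)).trans (Submodule.le_topologicalClosure _)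
      exact (projLE_iff_range_le (hp P hP).one_sub hK).2 hr
    have h' : ∀ x, K ((1 - P) x) = (1 - P) x := hKP.apply' (hp P hP).one_sub hK
    ext x
    have := h' x
    simp only [sub_apply, one_apply_eq_self, map_sub] at this
    simp only [mul_apply_eq_comp, sub_apply,
      one_apply_eq_self]
    rw [sub_eq_sub_iff_add_eq_add] at this ⊢
    rw [add_comm (P x), ← this, add_comm]
  · intro x ε hε
    have hev : ∀ᶠ A in l, dist ((1 - A) x) ((1 - K) x) < ε :=
      (Metric.tendsto_nhds.1 (hlim' x)) ε hε
    obtain ⟨A, hA, hA'⟩ := (hlS'.and hev).exists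
    exact ⟨1 - A, hA, by rwa [← dist_eq_norm]⟩

/-- Intermediate values: along a continuous nest the norm of `P v` takes every value between `0`
and `‖v‖`. -/
theorem IsContinuousNest.exists_norm_apply_eq (hL : IsContinuousNest L) (v : H) {s : ℝ}
    (hs : 0 ≤ s) (hsv : s ≤ ‖v‖) : ∃ P ∈ L, ‖P v‖ = s := by
  obtain ⟨Q, hQ, hle, happ⟩ := hL.exists_inf (S := {P | P ∈ L ∧ s ≤ ‖P v‖}) (fun P h => h.1)
    ⟨1, hL.one_mem, by simpa using hsv⟩
  refine ⟨Q, hQ, le_antisymm ?_ ?_⟩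
  · by_cases hne : {R | R ∈ L ∧ ProjLT R Q}.Nonempty
    · obtain ⟨l, hl, hlS, hlim⟩ := exists_filter_tendsto_projSup
        (fun P h => hL.isStarProjection P h.1) hne (fun P h R h' => hL.total P h.1 R h'.1)
      have h := hlim v
      rw [show projSup {R | R ∈ L ∧ ProjLT R Q} = Q from hL.pred_eq Q hQ] at h
      refine le_of_tendsto h.norm (hlS.mono fun R hR => ?_)
      by_contra! hlt
      -- otherwise `R` would be one of the projections of which `Q` is the infimum
      have hQR := hle R ⟨hR.1, hlt.le⟩
      refine hR.2.2 ?_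
      ext x
      rw [← hQR.apply' (hL.isStarProjection Q hQ) (hL.isStarProjection R hR.1) x, hR.2.1.apply]
    · have h := hL.pred_eq Q hQ
      rw [Set.not_nonempty_iff_eq_empty] at hne
      have hQ0 : Q = 0 := by
        rw [← h, predProj, hne, projSup]
        simp
      simpa [hQ0] using hs
  · refine le_of_forall_pos_le_add fun ε hε => ?_
    obtain ⟨P, hP, hPQ⟩ := happ v ε hε
    have := norm_sub_norm_le (P v) (Q v)
    linarith [hP.2]

theorem IsContinuousNest.exists_norm_sub_apply_eq (hL : IsContinuousNest L) (v : H) {s : ℝ}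
    (hs : 0 ≤ s) (hsv : s ≤ ‖v‖) : ∃ P ∈ L, ‖v - P v‖ = s := by
  obtain ⟨P, hP, h⟩ := hL.exists_norm_apply_eq v (Real.sqrt_nonneg (‖v‖ ^ 2 - s ^ 2))
    (Real.sqrt_le_iff.2 ⟨norm_nonneg v, by nlinarith⟩)
  refine ⟨P, hP, ?_⟩
  have e := ProjLE.norm_sub_apply_sq (hL.isStarProjection P hP)
    (show P * 1 = P from mul_one P) v
  rw [h, Real.sq_sqrt (by nlinarith), one_apply_eq_self, sub_sub_cancel] at e
  exact (sq_eq_sq₀ (norm_nonneg _) hs).1 e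

end Nest

variable {L : Set (H →L[ℂ] H)} {M : Submodule ℂ (H →L[ℂ] H)}

/-! ### Rank-one operators produced by Lie brackets -/

theorem mul_rankOne (A : H →L[ℂ] H) (x y : H) : A * rankOne ℂ x y = rankOne ℂ (A x) y :=
  comp_rankOne x y A

theorem isRankOne_rankOne {u v : H} (hu : u ≠ 0) (hv : v ≠ 0) : IsRankOne (rankOne ℂ u v) := by
  have e : (rankOne ℂ u v).range = ℂ ∙ u := by
    apply le_antisymm
    · rintro _ ⟨z, rfl⟩
      exact Submodule.mem_span_singleton.2 ⟨inner ℂ v z, rfl⟩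
    · rw [Submodule.span_singleton_le_iff_mem]
      refine ⟨(inner ℂ v v)⁻¹ • v, ?_⟩
      change rankOne ℂ u v _ = u
      rw [rankOne_apply, inner_smul_right, inv_mul_cancel₀ (inner_self_ne_zero.2 hv), one_smul]
  rw [IsRankOne, e]
  exact finrank_span_singleton hu

variable [CompleteSpace H]

theorem rankOne_mul (A : H →L[ℂ] H) (x y : H) :
    rankOne ℂ x y * A = rankOne ℂ x (A.adjoint y) :=
  rankOne_comp x y A

theorem IsNest.rankOne_mem_nestAlgebra (hL : IsNest L) {P : H →L[ℂ] H} (hP : P ∈ L) {x y : H}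
    (hx : P x = x) (hy : P y = 0) : rankOne ℂ x y ∈ nestAlgebra L := by
  intro R hR z hz
  have hPs := hL.isStarProjection P hP
  have hRs := hL.isStarProjection R hR
  rw [mem_range_iff hRs] at hz ⊢
  rw [rankOne_apply, map_smul]
  rcases hL.total P hP R hR with h | h
  · rw [← hx, h.apply' hPs hRs]
  · have : inner ℂ y z = 0 := by
      rw [← hz, ← h.apply' hRs hPs, ← inner_apply_left hPs, hy, inner_zero_left]
    simp [this]

theorem IsNest.mem_nestAlgebra (hL : IsNest L) {P : H →L[ℂ] H} (hP : P ∈ L) :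
    P ∈ nestAlgebra L := by
  intro R hR z hz
  have hPs := hL.isStarProjection P hP
  have hRs := hL.isStarProjection R hR
  rw [mem_range_iff hRs] at hz ⊢
  rcases hL.total P hP R hR with h | h
  · rw [h.apply' hPs hRs]
  · rw [← hz, h.apply' hRs hPs, hz, hz]

/-- The sum and the difference of `[T, P]` and `[[T, P], P]` are twice the corners of `T`. -/
theorem IsLieModule.corners_mem (hL : IsNest L) (hM : IsLieModule L M) {T P : H →L[ℂ] H}
    (hT : T ∈ M) (hP : P ∈ L) : P * T * (1 - P) ∈ M ∧ (1 - P) * T * P ∈ M := by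
  have hPP : P * P = P := (hL.isStarProjection P hP).isIdempotentElem.eq
  have h1 := hM T hT P (hL.mem_nestAlgebra hP)
  have h2 := hM _ h1 P (hL.mem_nestAlgebra hP)
  have e : (T * P - P * T) * P - P * (T * P - P * T)
      = T * P - P * T * P - P * T * P + P * T := by
    simp only [sub_mul, mul_sub, mul_assoc, hPP]
    rw [← mul_assoc P P, hPP]
    abel
  rw [e] at h2
  have h3 := M.smul_mem (2⁻¹ : ℂ) (M.sub_mem h2 h1)
  have h4 := M.smul_mem (2⁻¹ : ℂ) (M.add_mem h2 h1)
  constructor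
  · convert! h3 using 1
    simp only [mul_sub, mul_one]
    module
  · convert! h4 using 1
    simp only [sub_mul, one_mul]
    module

/-- If `Q ≤ R ≤ P` and `(R - Q) T (P - R) ≠ 0`, then `M` contains every rank-one operator with
range in that of `Q` and kernel containing the range of `P`. -/
theorem IsLieModule.rankOne_mem_of_upper (hL : IsNest L) (hM : IsLieModule L M)
    {T P Q R : H →L[ℂ] H} (hT : T ∈ M) (hP : P ∈ L) (hQ : Q ∈ L) (hR : R ∈ L)
    (hQR : ProjLE Q R) (hRP : ProjLE R P) {z : H} (hPz : P z = z) (hRz : R z = 0)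
    (hne : R (T z) - Q (T z) ≠ 0) {u v : H} (hu : Q u = u) (hv : P v = 0) :
    rankOne ℂ u v ∈ M := by
  have hPs := hL.isStarProjection P hP
  have hQs := hL.isStarProjection Q hQ
  have hRs := hL.isStarProjection R hR
  set B := R * T * (1 - R) with hB
  have hBM : B ∈ M := (hM.corners_mem hL hT hR).1
  set w := R (T z) - Q (T z) with hw
  have hQw : Q w = 0 := by rw [hw, map_sub, hQR.apply, idem_apply hQs, sub_self]
  have hRw : R w = w := by rw [hw, map_sub, hQR.apply' hQs hRs, idem_apply hRs]
  have hRu : R u = u := by rw [← hu, hQR.apply' hQs hRs]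
  have hBu : B u = 0 := by simp [hB, hRu]
  have hBz : B z = R (T z) := by simp [hB, hRz]
  have h1 := hM B hBM _ (hL.rankOne_mem_nestAlgebra hQ hu hQw)
  rw [mul_rankOne, rankOne_mul, hBu, map_zero, zero_apply, zero_sub,
    M.neg_mem_iff] at h1
  have h2 := hM _ h1 _ (hL.rankOne_mem_nestAlgebra hP hPz hv)
  have hvu : inner ℂ v u = 0 := by
    rw [← hRu, ← hRP.apply' hRs hPs, ← inner_apply_left hPs, hv, inner_zero_left]
  have hwB : inner ℂ w (R (T z)) = inner ℂ w w := by
    have : inner ℂ w (Q (T z)) = 0 := by rw [← inner_apply_left hQs, hQw, inner_zero_left]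
    conv_rhs => rw [hw]
    rw [← hw, inner_sub_right, this, sub_zero]
  rw [mul_rankOne, mul_rankOne, rankOne_apply, rankOne_apply, hvu, zero_smul, map_zero,
    zero_apply, sub_zero, ContinuousLinearMap.adjoint_inner_left, hBz, hwB,
    map_smul, smul_apply] at h2
  exact (M.smul_mem_iff (inner_self_ne_zero.2 hne)).1 h2

/-- If `P ≤ Q` and `(1 - Q) T P ≠ 0`, then `M` contains every `u ⊗ v` with `Q u = u`, `P v = 0`
and `u ⟂ v`. With `B = (1 - Q) T P` and `x = B z ≠ 0`, this comes from the double bracket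
`[[B, z ⊗ v], u ⊗ x]`, first for `u = z`, `v = x`. -/
theorem IsLieModule.rankOne_mem_of_lower_of_inner_eq_zero (hL : IsNest L) (hM : IsLieModule L M)
    {T P Q : H →L[ℂ] H} (hT : T ∈ M) (hP : P ∈ L) (hQ : Q ∈ L) (hPQ : ProjLE P Q)
    {z : H} (hPz : P z = z) (hne : Q (T z) ≠ T z) {u v : H} (hu : Q u = u) (hv : P v = 0)
    (huv : inner ℂ v u = 0) : rankOne ℂ u v ∈ M := by
  have hPs := hL.isStarProjection P hP
  have hQs := hL.isStarProjection Q hQ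
  have hPQ' : P * Q = P := hPQ
  have hQP' : Q * P = P := by ext y; exact hPQ.apply' hPs hQs y
  set B := (1 - Q) * T * P with hB
  have hBM : B ∈ M := by
    have h1 := (hM.corners_mem hL hT hP).2
    have h2 := hM _ h1 Q (hL.mem_nestAlgebra hQ)
    convert! h2 using 1
    rw [mul_assoc _ P Q, hPQ', ← mul_assoc Q, ← mul_assoc Q, mul_sub Q, hQP', mul_one, ← sub_mul,
      ← sub_mul, hB]
    congr 2
    abel
  set x := T z - Q (T z) with hx
  have hx0 : x ≠ 0 := sub_ne_zero.2 hne.symm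
  have hBz : B z = x := by simp [hB, hPz, hx]
  have hQx : Q x = 0 := by rw [hx, map_sub, idem_apply hQs, sub_self]
  have hPx : P x = 0 := by rw [← hPQ.apply, hQx, map_zero]
  have hQz : Q z = z := by rw [← hPz, hPQ.apply' hPs hQs]
  have hxQ : ∀ a, Q a = a → inner ℂ x a = 0 := fun a ha => by
    rw [← ha, ← inner_apply_left hQs, hQx, inner_zero_left]
  have key : ∀ a b, Q a = a → P b = 0 → inner ℂ b a = 0 →
      inner ℂ b (B a) • rankOne ℂ z x + inner ℂ x x • rankOne ℂ a b ∈ M := by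
    intro a b ha hb hab
    have h1 := hM B hBM _ (hL.rankOne_mem_nestAlgebra hP hPz hb)
    rw [mul_rankOne, rankOne_mul, hBz] at h1
    have h2 := hM _ h1 _ (hL.rankOne_mem_nestAlgebra hQ ha hQx)
    rw [mul_rankOne, mul_sub, mul_rankOne, mul_rankOne] at h2
    simp only [sub_apply, rankOne_apply, hab, zero_smul, hxQ z hQz,
      ContinuousLinearMap.adjoint_inner_left, map_zero, zero_apply,
      zero_sub, sub_zero, map_neg, map_smul, neg_apply,
      smul_apply] at h2
    convert! M.neg_mem h2 using 1
    abel
  have hxx : inner ℂ x x ≠ 0 := inner_self_ne_zero.2 hx0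
  have hzx : rankOne ℂ z x ∈ M := by
    have h := key z x hQz hPx (hxQ z hQz)
    rw [hBz, ← add_smul] at h
    exact (M.smul_mem_iff (by rw [← two_mul]; exact mul_ne_zero two_ne_zero hxx)).1 h
  have h := key u v hu hv huv
  rw [M.add_mem_iff_right (M.smul_mem _ hzx)] at h
  exact (M.smul_mem_iff hxx).1 h

/-! ### Block-diagonal parts along fine partitions of a continuous nest -/

theorem IsContinuousNest.exists_partition (hL : IsContinuousNest L) {v : H} (hv : v ≠ 0) {c : ℝ}
    (hc : 0 < c) : ∃ (n : ℕ) (f : ℕ → (H →L[ℂ] H)), (∀ k, f k ∈ L) ∧ f 0 = 0 ∧ f n = 1 ∧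
      ∀ k < n, ProjLE (f k) (f (k + 1)) ∧ ‖f (k + 1) v - f k v‖ ≤ c := by
  obtain ⟨n, hn⟩ := exists_nat_gt (‖v‖ ^ 2 / c ^ 2)
  have hn0 : (0 : ℝ) < n := lt_of_le_of_lt (by positivity) hn
  have hv0 : 0 < ‖v‖ := norm_pos_iff.2 hv
  have hex : ∀ k : ℕ, ∃ P ∈ L, (k = 0 → P = 0) ∧ (n ≤ k → P = 1) ∧
      (k ≤ n → ‖P v‖ ^ 2 = ‖v‖ ^ 2 * (k / n)) := by
    intro k
    rcases Nat.eq_zero_or_pos k with rfl | hk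
    · refine ⟨0, hL.zero_mem, fun _ => rfl, fun h => ?_, fun _ => by simp⟩
      exact absurd hn0 (by simp [Nat.le_zero.1 h])
    rcases le_or_gt n k with hnk | hnk
    · refine ⟨1, hL.one_mem, fun h => absurd h hk.ne', fun _ => rfl, fun h => ?_⟩
      rw [le_antisymm h hnk, div_self hn0.ne', mul_one, one_apply_eq_self]
    · have h1 : (k : ℝ) / n ≤ 1 := (div_le_one hn0).2 (by exact_mod_cast hnk.le)
      obtain ⟨P, hP, h⟩ := hL.exists_norm_apply_eq v (s := ‖v‖ * √(k / n)) (by positivity)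
        (mul_le_of_le_one_right (norm_nonneg v) (Real.sqrt_le_one.2 h1))
      refine ⟨P, hP, fun h => absurd h hk.ne', fun h => absurd h hnk.not_ge, fun _ => ?_⟩
      rw [h, mul_pow, Real.sq_sqrt (by positivity)]
  choose f hfL hf0 hf1 hfv using hex
  have hp : ∀ k, IsStarProjection (f k) := fun k => hL.isStarProjection _ (hfL k)
  have hstep : ∀ k < n, ‖f (k + 1) v‖ ^ 2 - ‖f k v‖ ^ 2 = ‖v‖ ^ 2 / n := by
    intro k hk
    rw [hfv k hk.le, hfv (k + 1) hk]
    push_cast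
    ring
  refine ⟨n, f, hfL, hf0 0 rfl, hf1 n le_rfl, fun k hk => ?_⟩
  have hle : ProjLE (f k) (f (k + 1)) := by
    refine (hL.total _ (hfL k) _ (hfL (k + 1))).resolve_right fun h => ?_
    have h1 := h.norm_sub_apply_sq (hp (k + 1)) v
    have h2 := hstep k hk
    have h3 : 0 < ‖v‖ ^ 2 / n := by positivity
    nlinarith [sq_nonneg ‖f k v - f (k + 1) v‖]
  refine ⟨hle, ?_⟩
  rw [← sq_le_sq₀ (norm_nonneg _) hc.le, hle.norm_sub_apply_sq (hp k), hstep k hk]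
  rw [div_lt_iff₀ (by positivity)] at hn
  rw [div_le_iff₀ hn0]
  linarith

/-- The norm of the block-diagonal part of `a ⊗ v` along a partition of the nest is controlled by
the largest block of `v`. -/
theorem norm_sum_rankOne_le {n : ℕ} {f : ℕ → (H →L[ℂ] H)} (hf : ∀ k, IsStarProjection (f k))
    (h0 : f 0 = 0) (h1 : f n = 1) (hle : ∀ k < n, ProjLE (f k) (f (k + 1))) (a v : H) {c : ℝ}
    (hc : 0 ≤ c) (hv : ∀ k < n, ‖f (k + 1) v - f k v‖ ≤ c) :
    ‖∑ k ∈ Finset.range n, rankOne ℂ (f (k + 1) a - f k a) (f (k + 1) v - f k v)‖ ≤ c * ‖a‖ := by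
  have hsum : ∀ y : H, ∑ k ∈ Finset.range n, ‖f (k + 1) y - f k y‖ ^ 2 = ‖y‖ ^ 2 := by
    intro y
    rw [Finset.sum_congr rfl fun k hk =>
      (hle k (Finset.mem_range.1 hk)).norm_sub_apply_sq (hf k) y,
      Finset.sum_range_sub (fun k => ‖f k y‖ ^ 2), h0, h1]
    simp
  refine ContinuousLinearMap.opNorm_le_bound _ (by positivity) fun z => ?_
  rw [sum_apply]
  calc ‖∑ k ∈ Finset.range n, rankOne ℂ (f (k + 1) a - f k a) (f (k + 1) v - f k v) z‖
      ≤ ∑ k ∈ Finset.range n, c * (‖f (k + 1) z - f k z‖ * ‖f (k + 1) a - f k a‖) := by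
        refine norm_sum_le_of_le _ fun k hk => ?_
        rw [Finset.mem_range] at hk
        have hE : inner ℂ (f (k + 1) v - f k v) z
            = inner ℂ (f (k + 1) v - f k v) (f (k + 1) z - f k z) := by
          have h := hle k hk
          simp only [inner_sub_left, inner_apply_left (hf _), map_sub, idem_apply (hf _), h.apply,
            h.apply' (hf k) (hf (k + 1)), sub_self, inner_zero_right, sub_zero, ← inner_sub_right]
        rw [rankOne_apply, norm_smul, hE, ← mul_assoc]
        gcongr
        exact (norm_inner_le_norm _ _).trans (by gcongr; exact hv k hk)
    _ ≤ c * (‖z‖ * ‖a‖) := by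
        rw [← Finset.mul_sum]
        gcongr
        refine (Real.sum_mul_le_sqrt_mul_sqrt _ _ _).trans_eq ?_
        rw [hsum, hsum, Real.sqrt_sq (norm_nonneg _), Real.sqrt_sq (norm_nonneg _)]
    _ = c * ‖a‖ * ‖z‖ := by ring

/-- A closed subspace contains `a ⊗ v` as soon as it contains its off-diagonal parts
`E a ⊗ (1 - E) v` for all intervals `E = Q - P` of the continuous nest. -/
theorem IsContinuousNest.rankOne_mem_of_off_diagonal (hL : IsContinuousNest L)
    (hM : IsClosed (M : Set (H →L[ℂ] H))) {a v : H}
    (h : ∀ P ∈ L, ∀ Q ∈ L, ProjLE P Q → rankOne ℂ (Q a - P a) (v - (Q v - P v)) ∈ M) :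
    rankOne ℂ a v ∈ M := by
  rcases eq_or_ne v 0 with rfl | hv
  · simp
  refine hM.closure_subset (Metric.mem_closure_iff.2 fun ε hε => ?_)
  obtain ⟨n, f, hfL, h0, h1, hstep⟩ := hL.exists_partition hv
    (show 0 < ε / (‖a‖ + 1) by positivity)
  have hD := norm_sum_rankOne_le (fun k => hL.isStarProjection _ (hfL k)) h0 h1
    (fun k hk => (hstep k hk).1) a v (by positivity) (fun k hk => (hstep k hk).2)
  refine ⟨∑ k ∈ Finset.range n, rankOne ℂ (f (k + 1) a - f k a) (v - (f (k + 1) v - f k v)),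
    M.sum_mem fun k hk => h _ (hfL k) _ (hfL (k + 1)) (hstep k (Finset.mem_range.1 hk)).1, ?_⟩
  have hsum : ∑ k ∈ Finset.range n, rankOne ℂ (f (k + 1) a - f k a) v = rankOne ℂ a v := by
    have := Finset.sum_range_sub (fun k => rankOne ℂ (f k a) v) n
    simp only [h0, h1, zero_apply, one_apply_eq_self, map_zero, sub_zero] at this
    simpa only [map_sub, sub_apply] using this
  rw [dist_eq_norm]
  have e : ∑ k ∈ Finset.range n, rankOne ℂ (f (k + 1) a - f k a) (v - (f (k + 1) v - f k v))
      = rankOne ℂ a v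
        - ∑ k ∈ Finset.range n, rankOne ℂ (f (k + 1) a - f k a) (f (k + 1) v - f k v) := by
    rw [← hsum, ← Finset.sum_sub_distrib]
    exact Finset.sum_congr rfl fun k _ => map_sub _ _ _
  rw [e, sub_sub_cancel]
  refine hD.trans_lt ?_
  rw [div_mul_eq_mul_div, div_lt_iff₀ (by positivity)]
  nlinarith

/-- A nonzero corner `(1 - Q) T P` with `P ≤ Q` puts every `u ⊗ v` with `Q u = u` and `P v = 0`
into `M`: the off-diagonal parts `E u` and `(1 - E) v` are orthogonal. -/
theorem IsLieModule.rankOne_mem_of_lower (hL : IsContinuousNest L) (hM : IsLieModule L M)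
    (hMc : IsClosed (M : Set (H →L[ℂ] H))) {T P Q : H →L[ℂ] H} (hT : T ∈ M) (hP : P ∈ L)
    (hQ : Q ∈ L) (hPQ : ProjLE P Q) {z : H} (hPz : P z = z) (hne : Q (T z) ≠ T z) {u v : H}
    (hu : Q u = u) (hv : P v = 0) : rankOne ℂ u v ∈ M := by
  have hcomm : ∀ A ∈ L, ∀ B ∈ L, ∀ y, A (B y) = B (A y) := by
    intro A hA B hB y
    have hAs := hL.isStarProjection A hA
    have hBs := hL.isStarProjection B hB
    rcases hL.total A hA B hB with h | h
    · rw [h.apply, h.apply' hAs hBs]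
    · rw [h.apply, h.apply' hBs hAs]
  refine hL.rankOne_mem_of_off_diagonal hMc fun R hR S hS hRS => ?_
  have hRs := hL.isStarProjection R hR
  have hSs := hL.isStarProjection S hS
  refine hM.rankOne_mem_of_lower_of_inner_eq_zero hL.toIsNest hT hP hQ hPQ hPz hne ?_ ?_ ?_
  · rw [map_sub, hcomm Q hQ S hS, hcomm Q hQ R hR, hu]
  · rw [map_sub, map_sub, hcomm P hP S hS, hcomm P hP R hR, hv]
    simp
  · simp only [inner_sub_left, inner_apply_left hSs, inner_apply_left hRs,
      idem_apply hSs, idem_apply hRs, hRS.apply, hRS.apply' hRs hSs, sub_self,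
      sub_zero, inner_sub_right]
    ring

/-! ### Finite rank operators -/

/-- For a finite rank operator `T` every nonempty totally ordered family of projections has a
member `P` for which the image of its range under `T` is the smallest. -/
theorem exists_minimal_image {S : Set (H →L[ℂ] H)} (hS : ∀ P ∈ S, IsStarProjection P)
    (hne : S.Nonempty) {T : H →L[ℂ] H} (hT : IsFiniteRank T) :
    ∃ P ∈ S, ∀ Q ∈ S, ProjLE Q P → ∀ z, P z = z → ∃ y, Q y = y ∧ T y = T z := by
  have hfin : FiniteDimensional ℂ T.range := hT
  let d : (H →L[ℂ] H) → ℕ := fun P => Module.finrank ℂ (P.range.map (T : H →ₗ[ℂ] H))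
  obtain ⟨P, hP, hmin⟩ := (measure d).wf.has_min S hne
  refine ⟨P, hP, fun Q hQ hQP z hz => ?_⟩
  have hle : Q.range.map (T : H →ₗ[ℂ] H) ≤ P.range.map (T : H →ₗ[ℂ] H) :=
    Submodule.map_mono ((projLE_iff_range_le (hS Q hQ) (hS P hP)).1 hQP)
  have hfinP : FiniteDimensional ℂ (P.range.map (T : H →ₗ[ℂ] H)) :=
    Submodule.finiteDimensional_of_le (LinearMap.map_le_range)
  have heq := Submodule.eq_of_le_of_finrank_le hle (not_lt.1 (hmin Q hQ))
  have hz' : T z ∈ P.range.map (T : H →ₗ[ℂ] H) := ⟨z, (mem_range_iff (hS P hP)).2 hz, rfl⟩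
  rw [← heq] at hz'
  obtain ⟨y, hy, e⟩ := hz'
  exact ⟨y, (mem_range_iff (hS Q hQ)).1 hy, e⟩

/-- If a finite rank operator `T` in `M` does not map the range of `P` into that of `Q`, then `M`
contains every rank-one operator with range in that of `Q` and kernel containing the range of
`P`. -/
theorem IsLieModule.rankOne_mem (hL : IsContinuousNest L) (hM : IsLieModule L M)
    (hMc : IsClosed (M : Set (H →L[ℂ] H))) {T P Q : H →L[ℂ] H} (hT : T ∈ M)
    (hfin : IsFiniteRank T) (hP : P ∈ L) (hQ : Q ∈ L) {z : H} (hPz : P z = z)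
    (hne : Q (T z) ≠ T z) {u v : H} (hu : Q u = u) (hv : P v = 0) : rankOne ℂ u v ∈ M := by
  have hproj := hL.isStarProjection
  rcases hL.total P hP Q hQ with hPQ | hQP
  · exact hM.rankOne_mem_of_lower hL hMc hT hP hQ hPQ hPz hne hu hv
  by_cases hinv : ∀ R ∈ L, ProjLE Q R → ProjLE R P → ∀ y, R y = y → R (T y) = T y
  · -- `T` leaves every `R` between `Q` and `P` invariant; take `R₀` between them with the image
    -- `T R₀` minimal among those not contained in `Q`
    obtain ⟨R₀, ⟨hR₀, hQR₀, hR₀P, y₀, hy₀, hne₀⟩, hmin⟩ := exists_minimal_image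
      (S := {R | R ∈ L ∧ ProjLE Q R ∧ ProjLE R P ∧ ∃ y, R y = y ∧ Q (T y) ≠ T y})
      (fun R h => hproj R h.1) ⟨P, hP, hQP, (hproj P hP).isIdempotentElem.eq, z, hPz, hne⟩ hfin
    set x := T y₀ - Q (T y₀) with hx
    have hx0 : 0 < ‖x‖ := norm_pos_iff.2 (sub_ne_zero.2 hne₀.symm)
    have hQx : Q x = 0 := by rw [hx, map_sub, idem_apply (hproj Q hQ), sub_self]
    have hR₀x : R₀ x = x := by
      rw [hx, map_sub, hQR₀.apply' (hproj Q hQ) (hproj R₀ hR₀), hinv R₀ hR₀ hQR₀ hR₀P y₀ hy₀]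
    obtain ⟨R, hR, hRx⟩ := hL.exists_norm_apply_eq x (s := ‖x‖ / 2) (by positivity) (by linarith)
    have hRx0 : R x ≠ 0 := norm_pos_iff.1 (by rw [hRx]; positivity)
    have hRxx : R x ≠ x := fun h => by rw [h] at hRx; linarith
    have hQR : ProjLE Q R := (hL.total Q hQ R hR).resolve_right fun h =>
      hRx0 (by rw [← h.apply, hQx, map_zero])
    have hRR₀ : ProjLE R R₀ := (hL.total R hR R₀ hR₀).resolve_right fun h =>
      hRxx (by rw [← hR₀x, h.apply' (hproj R₀ hR₀) (hproj R hR)])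
    have hRP : ProjLE R P := by
      ext y
      rw [mul_apply_eq_comp, ← hRR₀.apply, hR₀P.apply, hRR₀.apply]
    have hTR : ∀ y, R y = y → Q (T y) = T y := by
      by_contra! hcon
      obtain ⟨y, hy, e⟩ := hmin R ⟨hR, hQR, hRP, hcon⟩ hRR₀ y₀ hy₀
      refine hRxx ?_
      have := hinv R hR hQR hRP y hy
      rw [e] at this
      rw [hx, map_sub, this, hQR.apply' (hproj Q hQ) (hproj R hR)]
    -- hence `(R - Q) T (P - R) y₀ = R x ≠ 0`
    refine hM.rankOne_mem_of_upper hL.toIsNest hT hP hQ hR hQR hRP (z := y₀ - R y₀) ?_ ?_ ?_ hu hv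
    · rw [map_sub, hRP.apply' (hproj R hR) (hproj P hP), ← hy₀,
        hR₀P.apply' (hproj R₀ hR₀) (hproj P hP)]
    · rw [map_sub, idem_apply (hproj R hR), sub_self]
    · have h1 := hTR (R y₀) (idem_apply (hproj R hR) y₀)
      have h2 : R (T (R y₀)) = T (R y₀) := by
        rw [← h1, hQR.apply' (hproj Q hQ) (hproj R hR)]
      have : R (T (y₀ - R y₀)) - Q (T (y₀ - R y₀)) = R x := by
        rw [hx, map_sub, map_sub, map_sub, map_sub, h1, h2,
          hQR.apply' (hproj Q hQ) (hproj R hR)]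
        abel
      rwa [this]
  · push Not at hinv
    obtain ⟨R, hR, hQR, hRP, y, hy, hy'⟩ := hinv
    refine hM.rankOne_mem_of_lower hL hMc hT hR hR (hproj R hR).isIdempotentElem.eq hy hy' ?_ ?_
    · rw [← hu, hQR.apply' (hproj Q hQ) (hproj R hR)]
    · rw [← hRP.apply, hv, map_zero]

/-- `R` is subordinate to `T` along `L` if it maps the range of `P` into that of `Q` whenever `T`
does, for all `P` and `Q` in `L`. -/
def IsSubordinate (L : Set (H →L[ℂ] H)) (R T : H →L[ℂ] H) : Prop :=
  ∀ P ∈ L, ∀ Q ∈ L, (∀ z, P z = z → Q (T z) = T z) → ∀ z, P z = z → Q (R z) = R z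

/-- Every finite rank operator is a finite sum of rank-one operators subordinate to it. The bound
`m` on the rank is the induction variable. -/
theorem exists_sum_rankOne_subordinate (hL : IsNest L) (m : ℕ) :
    ∀ T : H →L[ℂ] H, IsFiniteRank T → Module.finrank ℂ T.range ≤ m →
      ∃ (n : ℕ) (u v : Fin n → H), (∀ i, u i ≠ 0 ∧ v i ≠ 0) ∧
        (∀ i, IsSubordinate L (rankOne ℂ (u i) (v i)) T) ∧
        T = ∑ i, rankOne ℂ (u i) (v i) := by
  induction m with
  | zero =>
    intro T hT hm
    have : FiniteDimensional ℂ T.range := hT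
    have hr : T.range = ⊥ := Submodule.finrank_eq_zero.1 (Nat.le_zero.1 hm)
    have hT0 : T = 0 := by
      ext x
      have : T x ∈ T.range := ⟨x, rfl⟩
      rw [hr] at this
      simpa using this
    exact ⟨0, Fin.elim0, Fin.elim0, fun i => i.elim0, fun i => i.elim0, by simp [hT0]⟩
  | succ m ih =>
    intro T hT hm
    have hfin : FiniteDimensional ℂ T.range := hT
    by_cases hT0 : T = 0
    · exact ⟨0, Fin.elim0, Fin.elim0, fun i => i.elim0, fun i => i.elim0, by simp [hT0]⟩
    obtain ⟨z₁, hz₁⟩ : ∃ z, T z ≠ 0 := by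
      by_contra! h
      exact hT0 (by ext z; simp [h z])
    obtain ⟨P₀, ⟨hP₀, z, hz, hTz⟩, hmin⟩ := exists_minimal_image
      (S := {P | P ∈ L ∧ ∃ z, P z = z ∧ T z ≠ 0}) (fun P h => hL.isStarProjection P h.1)
      ⟨1, hL.one_mem, z₁, rfl, hz₁⟩ hT
    set x := T z with hx
    have hxx : inner ℂ x x ≠ 0 := inner_self_ne_zero.2 hTz
    set R := rankOne ℂ ((inner ℂ x x)⁻¹ • x) (T.adjoint x) with hR
    have hRy : ∀ y, R y = (inner ℂ x (T y) * (inner ℂ x x)⁻¹) • x := fun y => by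
      rw [hR, rankOne_apply, ContinuousLinearMap.adjoint_inner_left, smul_smul]
    have hRT : IsSubordinate L R T := by
      intro P hP Q hQ h y hy
      rw [hRy, map_smul]
      by_cases hPT : ∃ w, P w = w ∧ T w ≠ 0
      · have hQx : Q x = x := by
          rcases hL.total P hP P₀ hP₀ with h' | h'
          · obtain ⟨w, hw, e⟩ := hmin P ⟨hP, hPT⟩ h' z hz
            rw [hx, ← e, h w hw]
          · refine h z ?_
            rw [← hz, h'.apply' (hL.isStarProjection P₀ hP₀) (hL.isStarProjection P hP)]
        rw [hQx]
      · push Not at hPT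
        simp [hPT y hy]
    have hsub : IsSubordinate L (T - R) T := fun P hP Q hQ h y hy => by
      rw [sub_apply, map_sub, h y hy, hRT P hP Q hQ h y hy]
    have hle : (T - R).range ≤ T.range := by
      rintro _ ⟨y, rfl⟩
      refine ⟨y - (inner ℂ x (T y) * (inner ℂ x x)⁻¹) • z, ?_⟩
      change T _ = T y - R y
      rw [map_sub, map_smul, hRy]
    have hlt : (T - R).range < T.range := by
      refine lt_of_le_of_ne hle fun h => hxx ?_
      have hxr : x ∈ T.range := ⟨z, rfl⟩
      rw [← h] at hxr
      obtain ⟨y, hy⟩ := hxr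
      have hy' : T y - R y = x := hy
      rw [← congrArg (inner ℂ x) hy', inner_sub_right, hRy, inner_smul_right, mul_assoc,
        inv_mul_cancel₀ hxx, mul_one, sub_self]
    have hTx : T.adjoint x ≠ 0 := fun h => by
      have h0 := ContinuousLinearMap.adjoint_inner_left T z x
      rw [h, inner_zero_left] at h0
      exact hxx h0.symm
    obtain ⟨n, u, v, hne, hs, hsum⟩ := ih (T - R) (Submodule.finiteDimensional_of_le hle)
      (Nat.le_of_lt_succ ((Submodule.finrank_lt_finrank_of_lt hlt).trans_le hm))
    refine ⟨n + 1, Fin.cons ((inner ℂ x x)⁻¹ • x) u, Fin.cons (T.adjoint x) v,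
      fun i => Fin.cases ⟨smul_ne_zero (inv_ne_zero hxx) hTz, hTx⟩ hne i,
      fun i => Fin.cases hRT (fun j P hP Q hQ h => hs j P hP Q hQ (hsub P hP Q hQ h)) i, ?_⟩
    rw [Fin.sum_univ_succ]
    simp only [Fin.cons_zero, Fin.cons_succ]
    rw [← hsum, ← hR, add_sub_cancel]

/-- A rank-one operator subordinate to a finite rank operator of `M` lies in `M`: it is the limit
of the operators `Q u ⊗ (1 - P) v` with `P v ≠ 0` small and `Q u ≠ u` close to `u`. -/
theorem IsLieModule.rankOne_mem_of_subordinate (hL : IsContinuousNest L) (hM : IsLieModule L M)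
    (hMc : IsClosed (M : Set (H →L[ℂ] H))) {T : H →L[ℂ] H} (hT : T ∈ M) (hfin : IsFiniteRank T)
    {u v : H} (hu : u ≠ 0) (hv : v ≠ 0) (hsub : IsSubordinate L (rankOne ℂ u v) T) :
    rankOne ℂ u v ∈ M := by
  have hproj := hL.isStarProjection
  have hε : ∀ n : ℕ, (0 : ℝ) < 1 / (n + 1) := fun n => Nat.one_div_pos_of_nat
  have hu0 := norm_pos_iff.2 hu
  have hv0 := norm_pos_iff.2 hv
  choose P hP hPv using fun n : ℕ => hL.exists_norm_apply_eq v
    (s := min (1 / (n + 1)) ‖v‖) (le_min (hε n).le hv0.le) (min_le_right _ _)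
  choose Q hQ hQu using fun n : ℕ => hL.exists_norm_sub_apply_eq u
    (s := min (1 / (n + 1)) ‖u‖) (le_min (hε n).le hu0.le) (min_le_right _ _)
  have hmem : ∀ n, rankOne ℂ (Q n u) (v - P n v) ∈ M := by
    intro n
    have hQn : Q n u ≠ u := fun h => by
      have h' := hQu n
      rw [h, sub_self, norm_zero] at h'
      exact (lt_min (hε n) hu0).ne h'
    have hPn : P n v ≠ 0 := norm_pos_iff.1 (by rw [hPv]; exact lt_min (hε n) hv0)
    have hTPQ : ∃ z, P n z = z ∧ Q n (T z) ≠ T z := by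
      by_contra! h
      have h1 := hsub _ (hP n) _ (hQ n) h (P n v) (idem_apply (hproj _ (hP n)) v)
      rw [rankOne_apply, map_smul, inner_self_apply (hproj _ (hP n))] at h1
      exact hQn (smul_right_injective H (by simpa using hPn) h1)
    obtain ⟨z, hz, hne⟩ := hTPQ
    refine hM.rankOne_mem hL hMc hT hfin (hP n) (hQ n) hz hne (idem_apply (hproj _ (hQ n)) u) ?_
    rw [map_sub, idem_apply (hproj _ (hP n)), sub_self]
  have hPlim : Tendsto (fun n => v - P n v) atTop (𝓝 v) := by
    have : Tendsto (fun n => P n v) atTop (𝓝 0) :=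
      squeeze_zero_norm (fun n => (hPv n).trans_le (min_le_left _ _))
        tendsto_one_div_add_atTop_nhds_zero_nat
    simpa using tendsto_const_nhds.sub this
  have hQlim : Tendsto (fun n => Q n u) atTop (𝓝 u) := by
    have : Tendsto (fun n => u - Q n u) atTop (𝓝 0) :=
      squeeze_zero_norm (fun n => (hQu n).trans_le (min_le_left _ _))
        tendsto_one_div_add_atTop_nhds_zero_nat
    simpa using (tendsto_const_nhds (x := u)).sub this
  have hcont : Continuous fun p : H × H => rankOne ℂ p.1 p.2 :=
    (ContinuousLinearMap.smulRightL ℂ H H).continuous₂.comp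
      (((innerSL ℂ).continuous.comp continuous_snd).prodMk continuous_fst)
  exact hMc.mem_of_tendsto ((hcont.tendsto (u, v)).comp (hQlim.prodMk_nhds hPlim))
    (Eventually.of_forall hmem)

end ContinuousNest

theorem theorem3p1 {H : Type*} [NormedAddCommGroup H] [InnerProductSpace ℂ H] [CompleteSpace H]
    [TopologicalSpace.SeparableSpace H]
    (L : Set (H →L[ℂ] H)) (hL : ContinuousNest.IsContinuousNest L)
    (M : Submodule ℂ (H →L[ℂ] H)) (hM : ContinuousNest.IsLieModule L M)
    (hMclosed : IsClosed (M : Set (H →L[ℂ] H))) :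
    ContinuousNest.IsDecomposable (M : Set (H →L[ℂ] H)) := by
  intro T hT hfin
  obtain ⟨n, u, v, hne, hsub, hsum⟩ :=
    ContinuousNest.exists_sum_rankOne_subordinate hL.toIsNest _ T hfin le_rfl
  exact ⟨n, fun i => InnerProductSpace.rankOne ℂ (u i) (v i), fun i =>
    ⟨hM.rankOne_mem_of_subordinate hL hMclosed hT hfin (hne i).1 (hne i).2 (hsub i),
      ContinuousNest.isRankOne_rankOne (hne i).1 (hne i).2⟩, hsum⟩
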